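/- Let $m,n\ge 1$, let $f=(f_1,\dots,f_m)\colon\mathbb{R}^n\to\mathbb{R}^m$ be locally Lipschitz, and let $\Omega\subset\mathbb{R}^n$ be nonempty and closed; $\mathbb{R}^n$ and $\mathbb{R}^m$ carry the Euclidean scalar product and norm. For $a,b\in\mathbb{R}^m$ write $a\leqq b$ if $b-a\in\mathbb{R}^m_+$. A point $\bar x\in\Omega$ is a Pareto efficient solution to the problem $$\mathrm{Min}_{\mathbb{R}^m_+}\{f(x)\mid x\in\Omega\}\tag{VP}$$ if there is no $x\in\Omega$ with $f(x)\leqq f(\bar x)$ and $f(x)\ne f(\bar x)$. For a set $S$ in a Euclidean space and $\bar x\in S$, let $\widehat N(\bar x;S)$ be the set of all $v$ with $\langle v,x-\bar x\rangle\le o(\|x-\bar x\|)$ as $x\to\bar x$, $x\in S$, and let $N(\bar x;S)$ be the set of all limits of sequences $v^k\in\widehat N(x^k;S)$ with $x^k\in S$, $x^k\to\bar x$. For $\phi\colon\mathbb{R}^n\to\mathbb{R}$ let $\partial\phi(x)=\{v\mid (v,-1)\in N((x,\phi(x));\mathrm{epi}\,\phi)\}$, where $\mathrm{epi}\,\phi=\{(x,t)\in\mathbb{R}^n\times\mathbb{R}\mid\phi(x)\le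 t\}$. For $x\in\Omega$ put $$\nu(x)=\inf\Big\{\Big\|\sum_{i=1}^m\lambda_iv^i+w\Big\|\;\Big|\;v^i\in\partial f_i(x)\cup\partial(-f_i)(x),\ w\in N(x;\Omega),\ \lambda\in\mathbb{R}^m_+,\ \sum_{i=1}^m\lambda_i=1\Big\},$$ and let $\Gamma(f,\Omega)$ be the set of all $x\in\Omega$ for which there are $v^i\in\partial f_i(x)\cup\partial(-f_i)(x)$, $i=1,\dots,m$, and $(\lambda,\mu)\in\mathbb{R}^m_+\times\mathbb{R}$ with $\sum_{i=1}^m\lambda_i+|\mu|=1$ and $0\in\sum_{i=1}^m\lambda_iv^i+\mu x+N(x;\Omega)$. For $\bar y\in\mathbb{R}^m$ define the following sets. - $\widetilde K_{\infty,\leqq\bar y}(f,\Omega)$ is the set of all $y\in\mathbb{R}^m$ for which there is a sequence $\{x^k\}\subset\Omega$ with $f(x^k)\leqq\bar y$ for all $k$, $\|x^k\|\to\infty$, $f(x^k)\to y$ and $\nu(x^k)\to0$. - $K_{\infty,\leqq\bar y}(f,\Omega)$ is defined in the same way with $\|x^k\|\,\nu(x^k)\to0$ in place of $\nu(x^k)\to0$.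 - $T_{\infty,\leqq\bar y}(f,\Omega)$ is the set of all $y\in\mathbb{R}^m$ for which there is a sequence $\{x^k\}\subset\Gamma(f,\Omega)$ with $f(x^k)\leqq\bar y$ for all $k$, $\|x^k\|\to\infty$ and $f(x^k)\to y$. **Claim.** Let $\bar y\in f(\Omega)$ be such that the section $[f(\Omega)]_{\bar y}:=f(\Omega)\cap(\bar y-\mathbb{R}^m_+)$ is bounded, i.e. contained in $a+\mathbb{R}^m_+$ for some $a\in\mathbb{R}^m$. Then the following conditions are equivalent, and if one (hence each) of them holds, then (VP) admits a Pareto efficient solution: 1. (properness at the sublevel $\bar y$) every sequence $\{x^k\}\subset\Omega$ with $\|x^k\|\to\infty$ and $f(x^k)\leqq\bar y$ for all $k$ satisfies $\|f(x^k)\|\to\infty$; 2. (Palais–Smale condition at $\bar y$) $\widetilde K_{\infty,\leqq\bar y}(f,\Omega)=\emptyset$; 3. (weak Palais–Smale condition at $\bar y$) $K_{\infty,\leqq\bar y}(f,\Omega)=\emptyset$; 4. (M-tameness at $\bar y$) $T_{\infty,\leqq\bar y}(f,\Omega)=\emptyset$. -/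

import Mathlib

open Filter Topology

noncomputable section

namespace VectorOpt

/-- `ℝ^n` with the usual scalar product and the Euclidean norm. -/
abbrev Euc (n : ℕ) : Type := EuclideanSpace ℝ (Fin n)

/-- The nonnegative orthant `ℝ^m_+`. -/
def nonnegOrthant (m : ℕ) : Set (Euc m) := {y | ∀ i, 0 ≤ y i}

/-- The componentwise order on `ℝ^m`: `a ≦ b` means `b - a ∈ ℝ^m_+`. -/
def Leqq {m : ℕ} (a b : Euc m) : Prop := b - a ∈ nonnegOrthant m

/-- `xbar ∈ Ω` is a Pareto efficient solution of minimizing `f` over `Ω` with respect to `ℝ^m_+`: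
there is no `x ∈ Ω` with `f x ≦ f xbar` and `f x ≠ f xbar`. -/
def IsParetoEfficient {n m : ℕ} (f : Euc n → Euc m) (Ω : Set (Euc n)) (xbar : Euc n) : Prop :=
  xbar ∈ Ω ∧ ¬ ∃ x ∈ Ω, Leqq (f x) (f xbar) ∧ f x ≠ f xbar

/-- The section `[A]_y = A ∩ (y - ℝ^m_+)`. -/
def sectionAt {m : ℕ} (A : Set (Euc m)) (y : Euc m) : Set (Euc m) := A ∩ {z | Leqq z y}

/-- The section `[A]_y` is bounded: `[A]_y ⊆ a + ℝ^m_+` for some `a`. -/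
def SectionBounded {m : ℕ} (A : Set (Euc m)) (y : Euc m) : Prop :=
  ∃ a : Euc m, ∀ z ∈ sectionAt A y, Leqq a z

section Normals

variable {E : Type*} [NormedAddCommGroup E] [InnerProductSpace ℝ E]

/-- The regular (Fréchet) normal cone to `S` at `xbar ∈ S`: all `v` such that
`⟪v, x - xbar⟫ ≤ o(‖x - xbar‖)` as `x → xbar` with `x ∈ S`. -/
def regularNormalCone (S : Set E) (xbar : E) : Set E :=
  {v | ∀ ε : ℝ, 0 < ε → ∀ᶠ x in 𝓝[S] xbar, inner ℝ v (x - xbar) ≤ ε * ‖x - xbar‖}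

/-- The limiting (Mordukhovich) normal cone to `S` at `xbar`. -/
def limitingNormalCone (S : Set E) (xbar : E) : Set E :=
  {v | ∃ x w : ℕ → E, (∀ k, x k ∈ S) ∧ Tendsto x atTop (𝓝 xbar) ∧
    (∀ k, w k ∈ regularNormalCone S (x k)) ∧ Tendsto w atTop (𝓝 v)}

end Normals

/-- The epigraph of `φ`, in `ℝ^n × ℝ` with its Euclidean structure. -/
def epigraph {n : ℕ} (φ : Euc n → ℝ) : Set (WithLp 2 (Euc n × ℝ)) := {p | φ p.fst ≤ p.snd}

/-- The limiting subdifferential `∂φ(x) = {v | (v, -1) ∈ N((x, φ x); epi φ)}`. -/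
def subdifferential {n : ℕ} (φ : Euc n → ℝ) (x : Euc n) : Set (Euc n) :=
  {v | WithLp.toLp 2 (v, (-1 : ℝ)) ∈
    limitingNormalCone (epigraph φ) (WithLp.toLp 2 (x, φ x))}

/-- The set `∂f_i(x) ∪ ∂(-f_i)(x)`. -/
def symSubdifferential {n m : ℕ} (f : Euc n → Euc m) (i : Fin m) (x : Euc n) : Set (Euc n) :=
  subdifferential (fun z => f z i) x ∪ subdifferential (fun z => -(f z i)) x

/-- The extended Rabier function of `f` restricted to `Ω`. For locally Lipschitz `f`, `1 ≤ m` and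
`x ∈ Ω` (the only points at which it is used) the infimum is over a nonempty set of nonnegative
numbers. -/
def rabier {n m : ℕ} (f : Euc n → Euc m) (Ω : Set (Euc n)) (x : Euc n) : ℝ :=
  sInf {r : ℝ | ∃ (v : Fin m → Euc n) (w : Euc n) (l : Fin m → ℝ),
    (∀ i, v i ∈ symSubdifferential f i x) ∧ w ∈ limitingNormalCone Ω x ∧
    (∀ i, 0 ≤ l i) ∧ ∑ i, l i = 1 ∧ r = ‖∑ i, l i • v i + w‖}

/-- The set `Γ(f, Ω)`; the last condition says `0 ∈ ∑ i, l i • v i + μ • x + N(x; Ω)`. -/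
def gammaSet {n m : ℕ} (f : Euc n → Euc m) (Ω : Set (Euc n)) : Set (Euc n) :=
  {x | x ∈ Ω ∧ ∃ (v : Fin m → Euc n) (l : Fin m → ℝ) (μ : ℝ),
    (∀ i, v i ∈ symSubdifferential f i x) ∧ (∀ i, 0 ≤ l i) ∧ ∑ i, l i + |μ| = 1 ∧
    ∃ w ∈ limitingNormalCone Ω x, 0 = ∑ i, l i • v i + μ • x + w}

/-- The set `K̃_{∞, ≦ ybar}(f, Ω)`. -/
def palaisSmaleSet {n m : ℕ} (f : Euc n → Euc m) (Ω : Set (Euc n)) (ybar : Euc m) :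
    Set (Euc m) :=
  {y | ∃ x : ℕ → Euc n, (∀ k, x k ∈ Ω) ∧ (∀ k, Leqq (f (x k)) ybar) ∧
    Tendsto (fun k => ‖x k‖) atTop atTop ∧ Tendsto (fun k => f (x k)) atTop (𝓝 y) ∧
    Tendsto (fun k => rabier f Ω (x k)) atTop (𝓝 0)}

/-- The set `K_{∞, ≦ ybar}(f, Ω)`. -/
def weakPalaisSmaleSet {n m : ℕ} (f : Euc n → Euc m) (Ω : Set (Euc n)) (ybar : Euc m) :
    Set (Euc m) :=
  {y | ∃ x : ℕ → Euc n, (∀ k, x k ∈ Ω) ∧ (∀ k, Leqq (f (x k)) ybar) ∧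
    Tendsto (fun k => ‖x k‖) atTop atTop ∧ Tendsto (fun k => f (x k)) atTop (𝓝 y) ∧
    Tendsto (fun k => ‖x k‖ * rabier f Ω (x k)) atTop (𝓝 0)}

/-- The set `T_{∞, ≦ ybar}(f, Ω)`. -/
def tangencySet {n m : ℕ} (f : Euc n → Euc m) (Ω : Set (Euc n)) (ybar : Euc m) :
    Set (Euc m) :=
  {y | ∃ x : ℕ → Euc n, (∀ k, x k ∈ gammaSet f Ω) ∧ (∀ k, Leqq (f (x k)) ybar) ∧
    Tendsto (fun k => ‖x k‖) atTop atTop ∧ Tendsto (fun k => f (x k)) atTop (𝓝 y)}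

/-- The restriction of `f` to `Ω` is proper at the sublevel `ybar`. -/
def ProperAtSublevel {n m : ℕ} (f : Euc n → Euc m) (Ω : Set (Euc n)) (ybar : Euc m) : Prop :=
  ∀ x : ℕ → Euc n, (∀ k, x k ∈ Ω) → Tendsto (fun k => ‖x k‖) atTop atTop →
    (∀ k, Leqq (f (x k)) ybar) → Tendsto (fun k => ‖f (x k)‖) atTop atTop

/-- The Palais--Smale condition at the sublevel `ybar`. -/
def PalaisSmaleAt {n m : ℕ} (f : Euc n → Euc m) (Ω : Set (Euc n)) (ybar : Euc m) : Prop :=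
  palaisSmaleSet f Ω ybar = ∅

/-- The weak Palais--Smale condition at the sublevel `ybar`. -/
def WeakPalaisSmaleAt {n m : ℕ} (f : Euc n → Euc m) (Ω : Set (Euc n)) (ybar : Euc m) : Prop :=
  weakPalaisSmaleSet f Ω ybar = ∅

/-- M-tameness at the sublevel `ybar`. -/
def MTameAt {n m : ℕ} (f : Euc n → Euc m) (Ω : Set (Euc n)) (ybar : Euc m) : Prop :=
  tangencySet f Ω ybar = ∅

end VectorOpt

end

namespace VectorOpt

/-! All four conditions say that the sublevel set U = {x ∈ Ω | f(x) ≦ ybar} is bounded. The values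
of f on U lie in a compact box, so properness can only hold when no sequence in U escapes to
infinity, and boundedness makes the three asymptotic sets empty trivially. Given bounded U,
minimizing ∑ f_i over the compact set U yields a Pareto efficient point.

For the converses, scalarize by φ = max_i (f_i - ybar_i), so that U = Ω ∩ {φ ≤ 0}. Suppose U is
unbounded. Points of U far out that nearly realize the lower limit of φ at infinity are perturbed by
a quadratic penalty at the scale of their norm; the resulting minimizers satisfy ‖x‖ ν(x) → 0
(`exists_norm_mul_rabier_le`). Minimizing φ over Ω intersected with large spheres gives points of
Γ(f, Ω) (`mem_gammaSet_of_isMinOn_sphere`). Compactness of the box makes the values converge along a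
subsequence.

Both constructions rest on one multiplier rule for max functions over Ω (`exists_multipliers`). It
is proved by decoupled penalization: each f_i gets its own copy of the variable, each partial
minimum is elementary, and the approximate multipliers pass to the limit. -/

theorem eventually_mul_norm_sq_le {E : Type*} [NormedAddCommGroup E] (K : ℝ) (x : E) {ε : ℝ} (hε : 0 < ε) :
    ∀ᶠ z in 𝓝 x, K * ‖z - x‖ ^ 2 ≤ ε * ‖z - x‖ := by
  have h : Tendsto (fun z => K * ‖z - x‖) (𝓝 x) (𝓝 0) := by
    have : Continuous fun z => K * ‖z - x‖ := by fun_prop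
    simpa using this.tendsto x
  filter_upwards [h.eventually (gt_mem_nhds hε)] with z hz
  nlinarith [norm_nonneg (z - x)]

/-! ### Regular and limiting normals -/

section NormalCones

variable {E : Type*} [NormedAddCommGroup E] [InnerProductSpace ℝ E]

theorem mem_limitingNormalCone_of_forall_exists {S : Set E} {x v : E}
    (h : ∀ ε : ℝ, 0 < ε → ∃ y ∈ S, dist y x < ε ∧ ∃ w ∈ regularNormalCone S y, dist w v < ε) :
    v ∈ limitingNormalCone S x := by
  choose! y hyS hyx w hw hwv using h
  have hpos : ∀ k : ℕ, (0 : ℝ) < 1 / ((k : ℝ) + 1) := fun k => by positivity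
  refine ⟨fun k => y (1 / ((k : ℝ) + 1)), fun k => w (1 / ((k : ℝ) + 1)),
    fun k => hyS _ (hpos k), ?_, fun k => hw _ (hpos k), ?_⟩
  · rw [tendsto_iff_dist_tendsto_zero]
    exact squeeze_zero (fun _ => dist_nonneg) (fun k => (hyx _ (hpos k)).le)
      tendsto_one_div_add_atTop_nhds_zero_nat
  · rw [tendsto_iff_dist_tendsto_zero]
    exact squeeze_zero (fun _ => dist_nonneg) (fun k => (hwv _ (hpos k)).le)
      tendsto_one_div_add_atTop_nhds_zero_nat

theorem exists_regular_of_mem_limitingNormalCone {S : Set E} {x v : E}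
    (h : v ∈ limitingNormalCone S x) {ε : ℝ} (hε : 0 < ε) :
    ∃ y ∈ S, dist y x < ε ∧ ∃ w ∈ regularNormalCone S y, dist w v < ε := by
  obtain ⟨y, w, hyS, hy, hw, hwv⟩ := h
  obtain ⟨k, hk1, hk2⟩ :=
    ((hy.eventually (Metric.ball_mem_nhds x hε)).and
      (hwv.eventually (Metric.ball_mem_nhds v hε))).exists
  exact ⟨y k, hyS k, hk1, w k, hw k, hk2⟩

/-- The graph of the limiting normal cone is sequentially closed. -/
theorem limitingNormalCone_of_tendsto {S : Set E} {x v : E} {y w : ℕ → E}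
    (hy : Tendsto y atTop (𝓝 x)) (hw : ∀ k, w k ∈ limitingNormalCone S (y k))
    (hwv : Tendsto w atTop (𝓝 v)) : v ∈ limitingNormalCone S x := by
  refine mem_limitingNormalCone_of_forall_exists fun ε hε => ?_
  obtain ⟨k, hk1, hk2⟩ :=
    ((hy.eventually (Metric.ball_mem_nhds x (half_pos hε))).and
      (hwv.eventually (Metric.ball_mem_nhds v (half_pos hε)))).exists
  obtain ⟨z, hzS, hz, u, hu, huw⟩ := exists_regular_of_mem_limitingNormalCone (hw k) (half_pos hε)
  exact ⟨z, hzS, by linarith [dist_triangle z (y k) x], u, hu,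
    by linarith [dist_triangle u (w k) v]⟩

theorem regularNormalCone_subset_limitingNormalCone {S : Set E} {x : E} (hx : x ∈ S) :
    regularNormalCone S x ⊆ limitingNormalCone S x := fun v hv =>
  ⟨fun _ => x, fun _ => v, fun _ => hx, tendsto_const_nhds, fun _ => hv, tendsto_const_nhds⟩

theorem smul_mem_regularNormalCone {S : Set E} {x v : E} {c : ℝ} (hc : 0 < c)
    (hv : v ∈ regularNormalCone S x) : c • v ∈ regularNormalCone S x := by
  intro ε hε
  filter_upwards [hv (ε / c) (by positivity)] with z hz
  rw [real_inner_smul_left]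
  calc c * inner ℝ v (z - x) ≤ c * (ε / c * ‖z - x‖) := by gcongr
    _ = ε * ‖z - x‖ := by field_simp

theorem smul_mem_limitingNormalCone {S : Set E} {x v : E} {c : ℝ} (hc : 0 < c)
    (hv : v ∈ limitingNormalCone S x) : c • v ∈ limitingNormalCone S x := by
  obtain ⟨y, w, hyS, hy, hw, hwv⟩ := hv
  exact ⟨y, fun k => c • w k, hyS, hy, fun k => smul_mem_regularNormalCone hc (hw k),
    hwv.const_smul c⟩

/-- Proximal normals are regular normals. -/
theorem mem_regularNormalCone_of_le_sq {S : Set E} {x v : E} (K : ℝ)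
    (h : ∀ᶠ z in 𝓝[S] x, inner ℝ v (z - x) ≤ K * ‖z - x‖ ^ 2) :
    v ∈ regularNormalCone S x := by
  intro ε hε
  filter_upwards [h, (eventually_mul_norm_sq_le K x hε).filter_mono nhdsWithin_le_nhds]
    with z h1 h2 using h1.trans h2

/-- Test with z = y - t A, divide by t and let t decrease to 0. With M = 0 this is Fermat's rule;
with M a Lipschitz constant plus ε it bounds regular subgradients. -/
theorem norm_le_of_eventually_inner_nonneg {A y : E} {M K : ℝ} (hM : 0 ≤ M)
    (h : ∀ᶠ z in 𝓝 y, 0 ≤ inner ℝ A (z - y) + M * ‖z - y‖ + K * ‖z - y‖ ^ 2) : ‖A‖ ≤ M := by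
  have hc : Tendsto (fun t : ℝ => y - t • A) (𝓝[>] 0) (𝓝 y) := by
    have : Continuous fun t : ℝ => y - t • A := by fun_prop
    simpa using (this.tendsto 0).mono_left nhdsWithin_le_nhds
  have h2 : Tendsto (fun t : ℝ => M * ‖A‖ + K * t * ‖A‖ ^ 2) (𝓝[>] 0) (𝓝 (M * ‖A‖)) := by
    have : Continuous fun t : ℝ => M * ‖A‖ + K * t * ‖A‖ ^ 2 := by fun_prop
    simpa using (this.tendsto 0).mono_left nhdsWithin_le_nhds
  have h3 : ‖A‖ ^ 2 ≤ M * ‖A‖ := by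
    refine ge_of_tendsto h2 ?_
    filter_upwards [hc.eventually h, self_mem_nhdsWithin] with t ht htpos
    have htpos : 0 < t := htpos
    have e1 : y - t • A - y = -(t • A) := by abel
    rw [e1, inner_neg_right, real_inner_smul_right, real_inner_self_eq_norm_sq, norm_neg,
      norm_smul, Real.norm_of_nonneg htpos.le] at ht
    have : 0 ≤ t * (M * ‖A‖ + K * t * ‖A‖ ^ 2 - ‖A‖ ^ 2) := by linarith [ht]
    linarith [nonneg_of_mul_nonneg_right this htpos]
  rcases (norm_nonneg A).eq_or_lt with h0 | h0
  · linarith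
  · nlinarith

end NormalCones

/-! ### Regular and limiting subgradients -/

/-- The regular (Fréchet) subdifferential. -/
def regularSubdifferential {n : ℕ} (φ : Euc n → ℝ) (y : Euc n) : Set (Euc n) :=
  {v | ∀ ε : ℝ, 0 < ε → ∀ᶠ z in 𝓝 y, φ y + inner ℝ v (z - y) ≤ φ z + ε * ‖z - y‖}

theorem mem_regularSubdifferential_of_le_sq {n : ℕ} {φ : Euc n → ℝ} {y v : Euc n} (K : ℝ)
    (h : ∀ᶠ z in 𝓝 y, φ y + inner ℝ v (z - y) ≤ φ z + K * ‖z - y‖ ^ 2) :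
    v ∈ regularSubdifferential φ y := by
  intro ε hε
  filter_upwards [h, eventually_mul_norm_sq_le K y hε] with z h1 h2
  linarith

theorem regularSubdifferential_subset_subdifferential {n : ℕ} (φ : Euc n → ℝ) (y : Euc n) :
    regularSubdifferential φ y ⊆ subdifferential φ y := by
  intro v hv
  refine regularNormalCone_subset_limitingNormalCone (S := epigraph φ)
    (show φ y ≤ φ y from le_rfl) fun ε hε => ?_
  have hc : Tendsto (fun p : WithLp 2 (Euc n × ℝ) => p.fst)
      (𝓝[epigraph φ] (WithLp.toLp 2 (y, φ y))) (𝓝 y) :=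
    ((WithLp.continuous_fst 2 (Euc n) ℝ).tendsto
      (WithLp.toLp 2 (y, φ y))).mono_left nhdsWithin_le_nhds
  filter_upwards [hc.eventually (hv ε hε), self_mem_nhdsWithin] with p hp hpe
  have hpe : φ p.fst ≤ p.snd := hpe
  have h1 : ‖p.fst - y‖ ≤ ‖p - WithLp.toLp 2 (y, φ y)‖ :=
    WithLp.norm_fst_le (Euc n) (p - WithLp.toLp 2 (y, φ y))
  have h2 : inner ℝ (WithLp.toLp 2 (v, (-1 : ℝ))) (p - WithLp.toLp 2 (y, φ y))
      = inner ℝ v (p.fst - y) - (p.snd - φ y) := by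
    rw [WithLp.prod_inner_apply]
    simp
    ring
  rw [h2]
  nlinarith

theorem subdifferential_of_tendsto {n : ℕ} {φ : Euc n → ℝ} {x v : Euc n} {y w : ℕ → Euc n}
    (hφ : Continuous φ) (hy : Tendsto y atTop (𝓝 x)) (hw : ∀ k, w k ∈ subdifferential φ (y k))
    (hwv : Tendsto w atTop (𝓝 v)) : v ∈ subdifferential φ x := by
  have hc : Continuous fun p : Euc n × ℝ => WithLp.toLp 2 p :=
    WithLp.prod_continuous_toLp 2 (Euc n) ℝ
  refine limitingNormalCone_of_tendsto (S := epigraph φ)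
    (y := fun k => WithLp.toLp 2 (y k, φ (y k))) (w := fun k => WithLp.toLp 2 (w k, (-1 : ℝ)))
    ?_ hw ?_
  · exact (hc.tendsto (x, φ x)).comp (hy.prodMk_nhds ((hφ.tendsto x).comp hy))
  · exact (hc.tendsto (v, -1)).comp (hwv.prodMk_nhds tendsto_const_nhds)

theorem norm_le_of_mem_regularSubdifferential {n : ℕ} {φ : Euc n → ℝ} {y v : Euc n} {L : ℝ}
    (hL : 0 ≤ L) (hLip : ∀ᶠ z in 𝓝 y, |φ z - φ y| ≤ L * ‖z - y‖)
    (hv : v ∈ regularSubdifferential φ y) : ‖v‖ ≤ L := by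
  refine le_of_forall_pos_le_add fun ε hε => ?_
  rw [← norm_neg]
  refine norm_le_of_eventually_inner_nonneg (y := y) (K := 0) (by positivity) ?_
  filter_upwards [hLip, hv ε hε] with z h1 h2
  rw [inner_neg_left]
  nlinarith [abs_le.1 h1]

/-- Regular subgradients of a locally Lipschitz function exist on a dense set. -/
theorem exists_regularSubgradient_near {n : ℕ} {φ : Euc n → ℝ} {x : Euc n} {L r : ℝ}
    (hL : 0 ≤ L) (hφ : Continuous φ)
    (hLip : ∀ y ∈ Metric.ball x r, ∀ z ∈ Metric.ball x r, |φ z - φ y| ≤ L * ‖z - y‖)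
    {ε : ℝ} (hε : 0 < ε) (hεr : ε < r) :
    ∃ y ∈ Metric.ball x ε, ∃ v ∈ regularSubdifferential φ y, ‖v‖ ≤ L := by
  -- Since k > L / ε, comparing the penalized minimizer y with x gives ‖y - x‖ ≤ L / k < ε, so y is
  -- interior and -2k(y - x) is a proximal subgradient there.
  set k : ℝ := L / ε + 1 with hk
  have hkpos : 0 < k := by positivity
  have hc : Continuous fun z => φ z + k * ‖z - x‖ ^ 2 := by fun_prop
  obtain ⟨y, hy, hmin⟩ := (isCompact_closedBall x ε).exists_isMinOn
    ⟨x, Metric.mem_closedBall_self hε.le⟩ hc.continuousOn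
  have hyr : y ∈ Metric.ball x r := Metric.closedBall_subset_ball hεr hy
  have h0 : φ y + k * ‖y - x‖ ^ 2 ≤ φ x := by
    simpa using hmin (Metric.mem_closedBall_self hε.le)
  have h1 := abs_le.1 (hLip x (Metric.mem_ball_self (hε.trans hεr)) y hyr)
  have hlt : ‖y - x‖ < ε := by
    by_contra! hge
    have : k * ε = L + ε := by rw [hk]; field_simp
    have h2 : k * ε * ‖y - x‖ ≤ L * ‖y - x‖ := by
      have : k * ε * ‖y - x‖ ≤ k * ‖y - x‖ ^ 2 := by
        rw [sq, mul_assoc]; gcongr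
      linarith
    nlinarith
  have hyε : y ∈ Metric.ball x ε := by rwa [mem_ball_iff_norm]
  have hv : (-(2 * k)) • (y - x) ∈ regularSubdifferential φ y := by
    refine mem_regularSubdifferential_of_le_sq k ?_
    filter_upwards [Metric.isOpen_ball.mem_nhds hyε] with z hz
    have h3 := hmin (Metric.ball_subset_closedBall hz)
    have h3 : φ y + k * ‖y - x‖ ^ 2 ≤ φ z + k * ‖z - x‖ ^ 2 := h3
    have h4 : z - x = (y - x) + (z - y) := by abel
    rw [h4, norm_add_sq_real] at h3
    rw [real_inner_smul_left]
    linarith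
  refine ⟨y, hyε, _, hv, norm_le_of_mem_regularSubdifferential hL ?_ hv⟩
  filter_upwards [Metric.isOpen_ball.mem_nhds hyr] with z hz using hLip y hyr z hz

/-! ### Approximate multiplier rule by decoupled penalization -/

/-- The squared positive part is differentiable with 2-Lipschitz derivative 2 max(·, 0), so its
linearization at a is exceeded by at most (b - a)². -/
theorem sq_max_zero_le (a b : ℝ) :
    (max b 0) ^ 2 ≤ (max a 0) ^ 2 + 2 * max a 0 * (b - a) + (b - a) ^ 2 := by
  rcases le_total a 0 with ha | ha <;> rcases le_total b 0 with hb | hb <;>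
    simp only [ha, hb, max_eq_left, max_eq_right] <;> nlinarith [sq_nonneg (b - a)]

theorem sum_update_eq {ι α : Type*} [Fintype ι] [DecidableEq ι] (h : ι → α → ℝ) (y : ι → α)
    (i : ι) (z : α) :
    ∑ j, h j (Function.update y i z j) = ∑ j, h j (y j) - h i (y i) + h i z := by
  rw [← Finset.add_sum_erase _ _ (Finset.mem_univ i),
    ← Finset.add_sum_erase _ (fun j => h j (y j)) (Finset.mem_univ i), Function.update_self]
  have : ∑ j ∈ Finset.univ.erase i, h j (Function.update y i z j)
      = ∑ j ∈ Finset.univ.erase i, h j (y j) :=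
    Finset.sum_congr rfl fun j hj => by rw [Function.update_of_ne (Finset.ne_of_mem_erase hj)]
  rw [this]
  ring

/-- Young's inequality bounds a + L b by half of k a² + k S + η, so the penalties absorb the error
in `h2`. In use, a is a positive part, b = ‖y_i - u‖, S the sum of all ‖y_i - u‖², and d = ‖u - x‖².
-/
theorem penalty_estimate {k L η s Q d S a b : ℝ} (hk : 1 ≤ k) (hη : 1 + L ^ 2 ≤ k * η)
    (hd : 0 ≤ d) (hbS : b ^ 2 ≤ S) (h1 : s + Q + d + k * a ^ 2 + k * S ≤ 0)
    (h2 : 0 ≤ s + a + L * b + Q) : d ≤ η ∧ S ≤ η ∧ -η ≤ s + Q ∧ s + Q ≤ 0 := by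
  have hk0 : 0 < k := by linarith
  have hS : 0 ≤ S := (sq_nonneg b).trans hbS
  have hX : 0 ≤ k * a ^ 2 := by positivity
  have hkS : S ≤ k * S := by nlinarith
  have h3 : 2 * (a + L * b) ≤ k * a ^ 2 + k * S + η := by
    have h4 : k * (2 * (a + L * b)) ≤ k * (k * a ^ 2 + k * S + η) := by
      have : k ^ 2 * b ^ 2 ≤ k ^ 2 * S := by gcongr
      nlinarith [sq_nonneg (k * a - 1), sq_nonneg (k * b - L)]
    exact le_of_mul_le_mul_left h4 hk0
  refine ⟨?_, ?_, ?_, ?_⟩ <;> linarith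

/-- Multiplier rule at a minimum in the slack variable. -/
theorem sum_multipliers_eq_one {m : ℕ} {k s : ℝ} (b : Fin m → ℝ)
    (h : ∀ᶠ z in 𝓝 s, s + ∑ i, k * (max (b i - s) 0) ^ 2 ≤ z + ∑ i, k * (max (b i - z) 0) ^ 2)
    (hk : 0 ≤ k) : ∑ i, 2 * k * max (b i - s) 0 = 1 := by
  have : ‖1 - ∑ i, 2 * k * max (b i - s) 0‖ ≤ 0 := by
    refine norm_le_of_eventually_inner_nonneg (y := s) (K := m * k) le_rfl ?_
    filter_upwards [h] with z hz
    have h1 : ∑ i, k * (max (b i - z) 0) ^ 2 ≤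
        ∑ i, (k * (max (b i - s) 0) ^ 2 + 2 * k * max (b i - s) 0 * (s - z) + k * (z - s) ^ 2) := by
      refine Finset.sum_le_sum fun i _ => ?_
      have h2 := mul_le_mul_of_nonneg_left (sq_max_zero_le (b i - s) (b i - z)) hk
      have h3 : b i - z - (b i - s) = s - z := by ring
      rw [h3] at h2
      linarith
    rw [Finset.sum_add_distrib, Finset.sum_add_distrib, ← Finset.sum_mul, Finset.sum_const,
      Finset.card_univ, Fintype.card_fin, nsmul_eq_mul] at h1
    rw [real_inner_eq_re_inner, RCLike.inner_apply]
    simp only [conj_trivial, RCLike.re_to_real, Real.norm_eq_abs, sq_abs, zero_mul, add_zero]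
    linarith
  have := norm_le_zero_iff.1 this
  linarith

/-- Multiplier rule at a minimum of a penalised Lipschitz function. -/
theorem exists_smul_regularSubgradient {n : ℕ} {φ : Euc n → ℝ} {u y : Euc n} {k c L : ℝ}
    (hk : 0 < k) (hL : 0 ≤ L) (hLip : ∀ᶠ z in 𝓝 y, |φ z - φ y| ≤ L * ‖z - y‖)
    (h : ∀ᶠ z in 𝓝 y, k * (max (φ y - c) 0) ^ 2 + k * ‖y - u‖ ^ 2 ≤
      k * (max (φ z - c) 0) ^ 2 + k * ‖z - u‖ ^ 2) :
    (2 * k) • (u - y) = 0 ∧ max (φ y - c) 0 = 0 ∨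
    ∃ v ∈ regularSubdifferential φ y, ‖v‖ ≤ L ∧
      (2 * k) • (u - y) = (2 * k * max (φ y - c) 0) • v := by
  set l : ℝ := 2 * k * max (φ y - c) 0 with hl
  have hl0 : 0 ≤ l := by positivity
  have key : ∀ᶠ z in 𝓝 y, inner ℝ ((2 * k) • (u - y)) (z - y) ≤
      l * (φ z - φ y) + k * (L ^ 2 + 1) * ‖z - y‖ ^ 2 := by
    filter_upwards [h, hLip] with z hz hz2
    have h2 := mul_le_mul_of_nonneg_left (sq_max_zero_le (φ y - c) (φ z - c)) hk.le
    have h3 : φ z - c - (φ y - c) = φ z - φ y := by ring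
    rw [h3] at h2
    have h4 : k * (φ z - φ y) ^ 2 ≤ k * (L * ‖z - y‖) ^ 2 := by
      refine mul_le_mul_of_nonneg_left ?_ hk.le
      rw [← sq_abs]
      gcongr
    have h5 : z - u = (y - u) + (z - y) := by abel
    rw [h5, norm_add_sq_real] at hz
    have h6 : u - y = -(y - u) := by abel
    rw [real_inner_smul_left, h6, inner_neg_left]
    nlinarith
  -- A positive multiplier l can be divided out to produce a subgradient; for l = 0 the estimate
  -- `key` is Fermat's rule and forces the vector to vanish.
  rcases hl0.eq_or_lt with h0 | h0
  · have hp : (2 * k) • (u - y) = 0 := by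
      rw [← norm_le_zero_iff, ← norm_neg]
      refine norm_le_of_eventually_inner_nonneg (y := y) (K := k * (L ^ 2 + 1)) le_rfl ?_
      filter_upwards [key] with z hz
      rw [← h0] at hz
      rw [inner_neg_left]
      linarith
    have : 2 * k ≠ 0 := by positivity
    exact Or.inl ⟨hp, (mul_eq_zero.1 h0.symm).resolve_left this⟩
  · right
    have hv : l⁻¹ • ((2 * k) • (u - y)) ∈ regularSubdifferential φ y := by
      refine mem_regularSubdifferential_of_le_sq (l⁻¹ * (k * (L ^ 2 + 1))) ?_
      filter_upwards [key] with z hz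
      have h2 := mul_le_mul_of_nonneg_left hz (inv_nonneg.2 hl0)
      rw [mul_add, inv_mul_cancel_left₀ h0.ne'] at h2
      rw [real_inner_smul_left]
      linarith
    exact ⟨_, hv, norm_le_of_mem_regularSubdifferential hL hLip hv,
      (smul_inv_smul₀ h0.ne' _).symm⟩

/-- Approximate multiplier rule for a local minimum over `Ω` of the maximum of the functions
`f i - c i` plus a quadratic perturbation. -/
theorem exists_approximate_multipliers {n m : ℕ} {f : Fin m → Euc n → ℝ} {Ω : Set (Euc n)}
    {x q : Euc n} {c : Fin m → ℝ} {C L r ε : ℝ} (hf : ∀ i, Continuous (f i)) (hΩ : IsClosed Ω)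
    (hx : x ∈ Ω) (hL : 0 ≤ L) (hr : 0 < r)
    (hLip : ∀ i, ∀ y ∈ Metric.ball x r, ∀ z ∈ Metric.ball x r, |f i z - f i y| ≤ L * ‖z - y‖)
    (hle : ∀ i, f i x ≤ c i)
    (hmin : ∀ z ∈ Ω, z ∈ Metric.ball x r → ∃ i, c i ≤ f i z + inner ℝ q (z - x) + C * ‖z - x‖ ^ 2)
    (hε : 0 < ε) :
    ∃ u ∈ Ω, dist u x < ε ∧ ∃ (y v : Fin m → Euc n) (l : Fin m → ℝ) (e : Euc n),
      (∀ i, dist (y i) x < ε) ∧ (∀ i, v i ∈ regularSubdifferential (f i) (y i)) ∧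
      (∀ i, ‖v i‖ ≤ L) ∧ (∀ i, 0 ≤ l i) ∧ ∑ i, l i = 1 ∧ ‖e‖ < ε ∧
      -(∑ i, l i • v i + q + e) ∈ regularNormalCone Ω u := by
  -- The fourth bound controls the error e = 2(C + 1)(u - x). The last keeps |Q u| < 1/2, which with
  -- η < 1/2 puts the slack s strictly inside [-1, 1].
  obtain ⟨δ, hδ, hδr, hδ1, hδε, hδq⟩ : ∃ δ : ℝ, 0 < δ ∧ δ < r ∧ δ < ε ∧
      2 * (|C| + 1) * δ < ε ∧ ‖q‖ * δ + |C| * δ ^ 2 < 1 / 2 := by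
    have hcont : ∀ g : ℝ → ℝ, Continuous g → Tendsto g (𝓝[>] 0) (𝓝 (g 0)) := fun g hg =>
      (hg.tendsto 0).mono_left nhdsWithin_le_nhds
    have h1 := (hcont (fun δ => δ) (by fun_prop)).eventually (gt_mem_nhds hr)
    have h2 := (hcont (fun δ => δ) (by fun_prop)).eventually (gt_mem_nhds hε)
    have h3 := (hcont (fun δ => 2 * (|C| + 1) * δ) (by fun_prop)).eventually
      (gt_mem_nhds (by simpa using hε))
    have h4 := (hcont (fun δ => ‖q‖ * δ + |C| * δ ^ 2) (by fun_prop)).eventually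
      (gt_mem_nhds (show ‖q‖ * 0 + |C| * 0 ^ 2 < 1 / 2 by norm_num))
    obtain ⟨δ, ⟨⟨⟨⟨h0, h1⟩, h2⟩, h3⟩, h4⟩⟩ :=
      ((((eventually_mem_nhdsWithin.and h1).and h2).and h3).and h4).exists
    exact ⟨δ, h0, h1, h2, h3, h4⟩
  obtain ⟨η, hη, hηδ, hη2⟩ : ∃ η : ℝ, 0 < η ∧ η < (δ / 2) ^ 2 ∧ η < 1 / 2 := by
    have : 0 < min ((δ / 2) ^ 2) (1 / 2) := by positivity
    obtain ⟨η, h1, h2⟩ := exists_between this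
    exact ⟨η, h1, h2.trans_le (min_le_left _ _), h2.trans_le (min_le_right _ _)⟩
  obtain ⟨k, hk1, hkη⟩ : ∃ k : ℝ, 1 ≤ k ∧ 1 + L ^ 2 ≤ k * η := by
    refine ⟨max 1 ((1 + L ^ 2) / η), le_max_left _ _, ?_⟩
    rw [← div_le_iff₀ hη]
    exact le_max_right _ _
  have hk0 : 0 < k := by linarith
  -- The constraints f_i(y_i) - c_i ≤ s and y_i = u are penalized. Each block then meets a single
  -- nonsmooth object (f_i for y_i, Ω for u), so minimizing blockwise replaces a subdifferential sum
  -- rule. The term ‖u - x‖² in F localizes the minimizer near x.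
  set H : Euc n → ℝ → Fin m → Euc n → ℝ := fun u s i z =>
    k * (max (f i z - c i - s) 0) ^ 2 + k * ‖z - u‖ ^ 2 with hH
  set Q : Euc n → ℝ := fun u => inner ℝ q (u - x) + C * ‖u - x‖ ^ 2 with hQ
  set F : Euc n × (Fin m → Euc n) × ℝ → ℝ := fun p =>
    p.2.2 + ∑ i, H p.1 p.2.2 i (p.2.1 i) + Q p.1 + ‖p.1 - x‖ ^ 2 with hF
  have hFc : Continuous F := by
    have := hf
    simp only [hF, hH, hQ]
    fun_prop
  have hcomp : IsCompact ((Ω ∩ Metric.closedBall x δ) ×ˢ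
      ((Set.univ.pi fun _ : Fin m => Metric.closedBall x δ) ×ˢ Set.Icc (-1 : ℝ) 1)) :=
    ((isCompact_closedBall x δ).inter_left hΩ).prod
      ((isCompact_univ_pi fun _ => isCompact_closedBall x δ).prod isCompact_Icc)
  have hxB : x ∈ Metric.closedBall x δ := Metric.mem_closedBall_self hδ.le
  obtain ⟨⟨u, y, s⟩, ⟨⟨huΩ, huB⟩, hyB, hs⟩, hm⟩ := hcomp.exists_isMinOn
    ⟨(x, fun _ => x, 0), ⟨⟨hx, hxB⟩, fun _ _ => hxB, by norm_num⟩⟩ hFc.continuousOn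
  have hyB : ∀ i, y i ∈ Metric.closedBall x δ := fun i => hyB i trivial
  have hm : ∀ u' ∈ Ω, u' ∈ Metric.closedBall x δ → ∀ y', (∀ i, y' i ∈ Metric.closedBall x δ) →
      ∀ s' ∈ Set.Icc (-1 : ℝ) 1, F (u, y, s) ≤ F (u', y', s') := fun u' h1 h2 y' h3 s' h4 =>
    hm (⟨⟨h1, h2⟩, fun i _ => h3 i, h4⟩ :
      ((u', y', s') : Euc n × (Fin m → Euc n) × ℝ) ∈ (Ω ∩ Metric.closedBall x δ) ×ˢ
      ((Set.univ.pi fun _ : Fin m => Metric.closedBall x δ) ×ˢ Set.Icc (-1 : ℝ) 1))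
  have hBr : Metric.closedBall x δ ⊆ Metric.ball x r := Metric.closedBall_subset_ball hδr
  have hF0 : F (u, y, s) ≤ 0 := by
    refine (hm x hx hxB (fun _ => x) (fun _ => hxB) 0 (by norm_num)).trans_eq ?_
    have : ∀ i, max (f i x - c i) 0 = 0 := fun i => max_eq_right (by linarith [hle i])
    simp [hF, hH, hQ, this]
  have hHnn : ∀ i, 0 ≤ H u s i (y i) := fun i => by simp only [hH]; positivity
  -- The local minimality of x, tested at u, gives the lower bound for s + Q u in terms of the
  -- penalties; `hF0` gives the opposite bound.
  obtain ⟨i₀, hi₀⟩ := hmin u huΩ (hBr huB)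
  have hest : ‖u - x‖ ^ 2 ≤ η ∧ ∑ i, ‖y i - u‖ ^ 2 ≤ η ∧ -η ≤ s + Q u ∧ s + Q u ≤ 0 := by
    refine penalty_estimate (a := max (f i₀ (y i₀) - c i₀ - s) 0) (b := ‖y i₀ - u‖) hk1 hkη
      (sq_nonneg _)
      (Finset.single_le_sum (f := fun i => ‖y i - u‖ ^ 2) (fun _ _ => sq_nonneg _)
        (Finset.mem_univ i₀)) ?_ ?_
    · have h1 : ∑ i, H u s i (y i)
          = ∑ i, k * (max (f i (y i) - c i - s) 0) ^ 2 + k * ∑ i, ‖y i - u‖ ^ 2 := by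
        rw [Finset.mul_sum, ← Finset.sum_add_distrib]
      have h2 := Finset.single_le_sum (f := fun i => k * (max (f i (y i) - c i - s) 0) ^ 2)
        (fun _ _ => by positivity) (Finset.mem_univ i₀)
      have h3 : s + ∑ i, H u s i (y i) + Q u + ‖u - x‖ ^ 2 ≤ 0 := hF0
      linarith
    · have h1 := (abs_le.1 (hLip i₀ u (hBr huB) (y i₀) (hBr (hyB i₀)))).1
      have h2 := le_max_left (f i₀ (y i₀) - c i₀ - s) 0
      simp only [hQ]
      linarith
  obtain ⟨hu2, hy2, hs1, hs2⟩ := hest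
  have hux : ‖u - x‖ < δ / 2 := lt_of_pow_lt_pow_left₀ 2 (by positivity) (hu2.trans_lt hηδ)
  have hyu : ∀ i, ‖y i - u‖ < δ / 2 := fun i =>
    lt_of_pow_lt_pow_left₀ 2 (by positivity) (((Finset.single_le_sum
      (f := fun i => ‖y i - u‖ ^ 2) (fun _ _ => sq_nonneg _)
      (Finset.mem_univ i)).trans hy2).trans_lt hηδ)
  have huball : u ∈ Metric.ball x δ := by rw [mem_ball_iff_norm]; linarith
  have hyball : ∀ i, y i ∈ Metric.ball x δ := fun i => by
    rw [mem_ball_iff_norm]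
    have := norm_add_le (y i - u) (u - x)
    rw [sub_add_sub_cancel] at this
    linarith [hyu i]
  have hQu : |Q u| < 1 / 2 := by
    refine lt_of_le_of_lt ?_ hδq
    have h1 : ‖u - x‖ ≤ δ := by linarith
    calc |Q u| ≤ |inner ℝ q (u - x)| + |C * ‖u - x‖ ^ 2| := abs_add_le _ _
      _ ≤ ‖q‖ * ‖u - x‖ + |C| * ‖u - x‖ ^ 2 := by
        rw [abs_mul, abs_of_nonneg (sq_nonneg ‖u - x‖)]
        gcongr
        exact abs_real_inner_le_norm q (u - x)
      _ ≤ _ := by gcongr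
  have hsint : s ∈ Set.Ioo (-1 : ℝ) 1 := by
    rw [abs_lt] at hQu
    constructor <;> linarith
  have hsum : ∑ i, 2 * k * max (f i (y i) - c i - s) 0 = 1 := by
    refine sum_multipliers_eq_one (fun i => f i (y i) - c i) ?_ hk0.le
    filter_upwards [isOpen_Ioo.mem_nhds hsint] with z hz
    have := hm u huΩ huB y hyB z (Set.Ioo_subset_Icc_self hz)
    simp only [hF, hH, Finset.sum_add_distrib] at this
    linarith
  have hsub : ∀ i, ∃ y' v, dist y' x < ε ∧ v ∈ regularSubdifferential (f i) y' ∧ ‖v‖ ≤ L ∧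
      (2 * k) • (u - y i) = (2 * k * max (f i (y i) - c i - s) 0) • v := by
    intro i
    have := exists_smul_regularSubgradient (φ := f i) (u := u) (y := y i) (c := c i + s)
      hk0 hL ?_ ?_
    · rw [← sub_sub] at this
      rcases this with ⟨h1, h2⟩ | ⟨v, hv, hvL, h1⟩
      -- With multiplier zero any bounded subgradient near x will do, so density of regular
      -- subgradients supplies one.
      · obtain ⟨y', hy', v, hv, hvL⟩ :=
          exists_regularSubgradient_near hL (hf i) (hLip i) hδ hδr
        exact ⟨y', v, (Metric.mem_ball.1 hy').trans hδ1, hv, hvL, by rw [h1, h2]; simp⟩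
      · exact ⟨y i, v, (Metric.mem_ball.1 (hyball i)).trans hδ1, hv, hvL, h1⟩
    · filter_upwards [Metric.isOpen_ball.mem_nhds (hyball i)] with z hz using
        hLip i _ (hBr (hyB i)) z (hBr (Metric.ball_subset_closedBall hz))
    · filter_upwards [Metric.isOpen_ball.mem_nhds (hyball i)] with z hz
      have h1 := hm u huΩ huB (Function.update y i z) (fun j => by
        rcases eq_or_ne j i with rfl | hj
        · rw [Function.update_self]; exact Metric.ball_subset_closedBall hz
        · rw [Function.update_of_ne hj]; exact hyB j) s hs
      have h2 := sum_update_eq (H u s) y i z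
      simp only [hF] at h1
      have h3 : H u s i (y i) ≤ H u s i z := by linarith
      simp only [← sub_sub]
      exact h3
  choose y' v hy' hv hvL hyv using hsub
  -- The multipliers are the derivatives of the squared positive parts, and e is the gradient at u
  -- of (C + 1)‖· - x‖².
  refine ⟨u, huΩ, (Metric.mem_ball.1 huball).trans hδ1, y', v,
    fun i => 2 * k * max (f i (y i) - c i - s) 0, (2 * (C + 1)) • (u - x), hy', hv, hvL,
    fun i => by positivity, hsum, ?_, ?_⟩
  · rw [norm_smul, Real.norm_eq_abs, abs_mul, abs_of_pos (zero_lt_two' ℝ)]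
    refine lt_of_le_of_lt ?_ hδε
    have : |C + 1| ≤ |C| + 1 := (abs_add_le C 1).trans_eq (by rw [abs_one])
    have h1 : ‖u - x‖ ≤ δ := by linarith
    gcongr
  · refine mem_regularNormalCone_of_le_sq (m * k + C + 1) ?_
    filter_upwards [self_mem_nhdsWithin, (Metric.isOpen_ball.mem_nhds huball :
      Metric.ball x δ ∈ 𝓝 u) |> mem_nhdsWithin_of_mem_nhds] with z hzΩ hzB
    have h1 := hm z hzΩ (Metric.ball_subset_closedBall hzB) y hyB s hs
    have h2 : ∀ i, H z s i (y i) = H u s i (y i) + inner ℝ ((2 * k) • (u - y i)) (z - u)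
        + k * ‖z - u‖ ^ 2 := fun i => by
      have e1 : y i - z = -((u - y i) + (z - u)) := by abel
      have e2 : y i - u = -(u - y i) := by abel
      simp only [hH]
      rw [e1, e2, norm_neg, norm_neg, norm_add_sq_real, real_inner_smul_left]
      ring
    have h3 : ∑ i, H z s i (y i) = ∑ i, H u s i (y i)
        + inner ℝ (∑ i, (2 * k * max (f i (y i) - c i - s) 0) • v i) (z - u)
        + m * (k * ‖z - u‖ ^ 2) := by
      simp only [h2, Finset.sum_add_distrib, ← sum_inner, hyv]
      simp
    have h4 : ‖z - x‖ ^ 2 = ‖u - x‖ ^ 2 + 2 * inner ℝ (u - x) (z - u) + ‖z - u‖ ^ 2 := by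
      rw [← norm_add_sq_real]; congr 2; abel
    have h5 : inner ℝ q (z - x) = inner ℝ q (u - x) + inner ℝ q (z - u) := by
      rw [← inner_add_right]; congr 1; abel
    simp only [hF, hQ] at h1
    rw [h3, h4, h5] at h1
    rw [inner_neg_left, inner_add_left, inner_add_left, real_inner_smul_left]
    linarith

/-! ### Limiting multiplier rule -/

/-- Multipliers and subgradients pass to the limit. -/
theorem exists_limit_multipliers {n m : ℕ} {f : Fin m → Euc n → ℝ} {Ω : Set (Euc n)}
    {x a b : Euc n} {L : ℝ} {P : Set ((Fin m → ℝ) × ℝ)} (hf : ∀ i, Continuous (f i))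
    (hP : IsCompact P) {u α β w : ℕ → Euc n} {y v : ℕ → Fin m → Euc n} {l : ℕ → Fin m → ℝ}
    {μ : ℕ → ℝ} (hu : Tendsto u atTop (𝓝 x)) (hα : Tendsto α atTop (𝓝 a))
    (hβ : Tendsto β atTop (𝓝 b)) (hy : ∀ i, Tendsto (fun k => y k i) atTop (𝓝 x))
    (hv : ∀ k i, v k i ∈ subdifferential (f i) (y k i)) (hvL : ∀ k i, ‖v k i‖ ≤ L)
    (hw : ∀ k, w k ∈ limitingNormalCone Ω (u k)) (hlμ : ∀ k, (l k, μ k) ∈ P)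
    (h0 : ∀ k, ∑ i, l k i • v k i + μ k • α k + β k + w k = 0) :
    ∃ (l : Fin m → ℝ) (μ : ℝ) (v : Fin m → Euc n) (w : Euc n), (l, μ) ∈ P ∧
      (∀ i, v i ∈ subdifferential (f i) x) ∧ (∀ i, ‖v i‖ ≤ L) ∧
      w ∈ limitingNormalCone Ω x ∧ ∑ i, l i • v i + μ • a + b + w = 0 := by
  have hcomp : IsCompact (P ×ˢ (Set.univ.pi fun _ : Fin m => Metric.closedBall (0 : Euc n) L)) :=
    hP.prod (isCompact_univ_pi fun _ => isCompact_closedBall _ _)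
  obtain ⟨⟨⟨l', μ'⟩, v'⟩, ⟨hP', hv'⟩, σ, hσ, hlim⟩ := hcomp.tendsto_subseq
    (x := fun k => ((l k, μ k), v k)) fun k => ⟨hlμ k, fun i _ => by simpa using hvL k i⟩
  have hσ' := hσ.tendsto_atTop
  have hl : ∀ i, Tendsto (fun k => l (σ k) i) atTop (𝓝 (l' i)) := fun i =>
    (((continuous_apply i).comp (continuous_fst.comp continuous_fst)).tendsto _).comp hlim
  have hμ : Tendsto (fun k => μ (σ k)) atTop (𝓝 μ') :=
    ((continuous_snd.comp continuous_fst).tendsto _).comp hlim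
  have hvv : ∀ i, Tendsto (fun k => v (σ k) i) atTop (𝓝 (v' i)) := fun i =>
    (((continuous_apply i).comp continuous_snd).tendsto _).comp hlim
  -- The normals need no a priori bound: the equation expresses w through terms that already
  -- converge.
  refine ⟨l', μ', v', -(∑ i, l' i • v' i + μ' • a + b), hP', fun i => ?_, fun i => ?_, ?_,
    by abel⟩
  · exact subdifferential_of_tendsto (hf i) ((hy i).comp hσ') (fun k => hv (σ k) i) (hvv i)
  · simpa using hv' i trivial
  · refine limitingNormalCone_of_tendsto (hu.comp hσ') (fun k => hw (σ k)) ?_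
    have h1 : ∀ k, w (σ k) =
        -(∑ i, l (σ k) i • v (σ k) i + μ (σ k) • α (σ k) + β (σ k)) := fun k =>
      eq_neg_of_add_eq_zero_right (h0 (σ k))
    simp only [h1]
    exact (((tendsto_finsetSum _ fun i _ => (hl i).smul (hvv i)).add
      (hμ.smul (hα.comp hσ'))).add (hβ.comp hσ')).neg

/-- Multiplier rule for a local minimum over `Ω` of the maximum of the functions
`f i - c i` plus a quadratic perturbation. -/
theorem exists_multipliers {n m : ℕ} {f : Fin m → Euc n → ℝ} {Ω : Set (Euc n)}
    {x q : Euc n} {c : Fin m → ℝ} {C L r : ℝ} (hf : ∀ i, Continuous (f i)) (hΩ : IsClosed Ω)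
    (hx : x ∈ Ω) (hL : 0 ≤ L) (hr : 0 < r)
    (hLip : ∀ i, ∀ y ∈ Metric.ball x r, ∀ z ∈ Metric.ball x r, |f i z - f i y| ≤ L * ‖z - y‖)
    (hle : ∀ i, f i x ≤ c i)
    (hmin : ∀ z ∈ Ω, z ∈ Metric.ball x r →
      ∃ i, c i ≤ f i z + inner ℝ q (z - x) + C * ‖z - x‖ ^ 2) :
    ∃ (v : Fin m → Euc n) (l : Fin m → ℝ) (w : Euc n),
      (∀ i, v i ∈ subdifferential (f i) x) ∧ (∀ i, ‖v i‖ ≤ L) ∧ (∀ i, 0 ≤ l i) ∧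
      ∑ i, l i = 1 ∧ w ∈ limitingNormalCone Ω x ∧ ∑ i, l i • v i + q + w = 0 := by
  have hpos : ∀ k : ℕ, (0 : ℝ) < 1 / ((k : ℝ) + 1) := fun k => by positivity
  choose u huΩ hux y v l e hy hv hvL hl hl1 he hN using fun k : ℕ =>
    exists_approximate_multipliers hf hΩ hx hL hr hLip hle hmin (hpos k)
  have hlim := tendsto_one_div_add_atTop_nhds_zero_nat (𝕜 := ℝ)
  have he0 : Tendsto e atTop (𝓝 0) :=
    squeeze_zero_norm (fun k => (he k).le) hlim
  obtain ⟨l', μ', v', w', ⟨hl', hμ'⟩, hv', hvL', hw', h0⟩ := exists_limit_multipliers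
    (Ω := Ω) (x := x) (a := 0) (b := q) (L := L) (P := stdSimplex ℝ (Fin m) ×ˢ {(0 : ℝ)})
    (u := u) (α := fun _ => 0) (β := fun k => q + e k) (y := y) (v := v) (l := l)
    (μ := fun _ => 0) hf
    ((isCompact_stdSimplex ℝ (Fin m)).prod isCompact_singleton)
    (tendsto_iff_dist_tendsto_zero.2
      (squeeze_zero (fun _ => dist_nonneg) (fun k => (hux k).le) hlim))
    tendsto_const_nhds (by simpa using he0.const_add q)
    (fun i => tendsto_iff_dist_tendsto_zero.2
      (squeeze_zero (fun _ => dist_nonneg) (fun k => (hy k i).le) hlim))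
    (fun k i => regularSubdifferential_subset_subdifferential _ _ (hv k i)) hvL
    (fun k => regularNormalCone_subset_limitingNormalCone (huΩ k) (hN k))
    (fun k => ⟨⟨hl k, hl1 k⟩, rfl⟩) (fun k => by simp [add_assoc])
  refine ⟨v', l', w', hv', hvL', hl'.1, hl'.2, hw', ?_⟩
  simpa using h0

/-! ### Sublevel set and max scalarization -/

theorem leqq_iff {m : ℕ} {a b : Euc m} : Leqq a b ↔ ∀ i, a i ≤ b i := by
  simp [Leqq, nonnegOrthant]

/-- The part of `Ω` on which `f` is at most `ybar`. -/
def sublevel {n m : ℕ} (f : Euc n → Euc m) (Ω : Set (Euc n)) (ybar : Euc m) : Set (Euc n) :=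
  {x | x ∈ Ω ∧ Leqq (f x) ybar}

/-- The scalarization `max_i (f_i - ybar_i)`. -/
def maxExcess {n m : ℕ} [NeZero m] (f : Euc n → Euc m) (ybar : Euc m) (x : Euc n) : ℝ :=
  Finset.univ.sup' Finset.univ_nonempty fun i => f x i - ybar i

theorem continuous_coord {n m : ℕ} {f : Euc n → Euc m} (hf : Continuous f) (i : Fin m) :
    Continuous fun z => f z i := by
  fun_prop

theorem exists_lipschitz_ball {n m : ℕ} {f : Euc n → Euc m} (hf : LocallyLipschitz f)
    (x : Euc n) :
    ∃ L r : ℝ, 0 ≤ L ∧ 0 < r ∧ ∀ i, ∀ y ∈ Metric.ball x r, ∀ z ∈ Metric.ball x r,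
      |f z i - f y i| ≤ L * ‖z - y‖ := by
  obtain ⟨K, t, ht, hK⟩ := hf x
  obtain ⟨r, hr, hrt⟩ := Metric.mem_nhds_iff.1 ht
  refine ⟨K, r, K.2, hr, fun i y hy z hz => ?_⟩
  have h1 := hK.dist_le_mul z (hrt hz) y (hrt hy)
  rw [dist_eq_norm, dist_eq_norm] at h1
  exact (PiLp.norm_apply_le (f z - f y) i).trans h1

section Scalarization

variable {n m : ℕ} [NeZero m] {f : Euc n → Euc m} {Ω : Set (Euc n)} {ybar : Euc m}

theorem le_maxExcess (x : Euc n) (i : Fin m) : f x i - ybar i ≤ maxExcess f ybar x :=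
  Finset.le_sup' (fun i => f x i - ybar i) (Finset.mem_univ i)

theorem exists_maxExcess_eq (f : Euc n → Euc m) (ybar : Euc m) (x : Euc n) :
    ∃ i, maxExcess f ybar x = f x i - ybar i := by
  obtain ⟨i, -, hi⟩ := Finset.exists_mem_eq_sup' (Finset.univ_nonempty (α := Fin m))
    fun i => f x i - ybar i
  exact ⟨i, hi⟩

theorem maxExcess_nonpos_iff {x : Euc n} : maxExcess f ybar x ≤ 0 ↔ Leqq (f x) ybar := by
  simp [maxExcess, leqq_iff]

theorem continuous_maxExcess (hf : Continuous f) : Continuous (maxExcess f ybar) :=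
  Continuous.finset_sup'_apply _ fun i _ => (continuous_coord hf i).sub continuous_const

/-- Take c_i = ybar_i + φ(x), with φ the max scalarization: then f_i(x) ≤ c_i for every i, and at a
nearby z the index attaining φ(z) provides the inequality that the multiplier rule requires. -/
theorem exists_multipliers_maxExcess (hf : Continuous f) (hΩ : IsClosed Ω) {x q : Euc n}
    {C L r : ℝ} (hx : x ∈ Ω) (hL : 0 ≤ L) (hr : 0 < r)
    (hLip : ∀ i, ∀ y ∈ Metric.ball x r, ∀ z ∈ Metric.ball x r, |f z i - f y i| ≤ L * ‖z - y‖)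
    (hmin : ∀ᶠ z in 𝓝[Ω] x,
      maxExcess f ybar x ≤ maxExcess f ybar z + inner ℝ q (z - x) + C * ‖z - x‖ ^ 2) :
    ∃ (v : Fin m → Euc n) (l : Fin m → ℝ) (w : Euc n),
      (∀ i, v i ∈ subdifferential (fun z => f z i) x) ∧ (∀ i, ‖v i‖ ≤ L) ∧ (∀ i, 0 ≤ l i) ∧
      ∑ i, l i = 1 ∧ w ∈ limitingNormalCone Ω x ∧ ∑ i, l i • v i + q + w = 0 := by
  obtain ⟨δ, hδ, hδm⟩ := Metric.mem_nhdsWithin_iff.1 hmin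
  refine exists_multipliers (f := fun i z => f z i) (c := fun i => ybar i + maxExcess f ybar x)
    (C := C) (r := min r δ) (continuous_coord hf) hΩ hx hL (lt_min hr hδ)
    (fun i y hy z hz => hLip i y (Metric.ball_subset_ball (min_le_left _ _) hy) z
      (Metric.ball_subset_ball (min_le_left _ _) hz))
    (fun i => by linarith [le_maxExcess (f := f) (ybar := ybar) x i]) fun z hzΩ hz => ?_
  obtain ⟨i, hi⟩ := exists_maxExcess_eq f ybar z
  have h1 : maxExcess f ybar x ≤ maxExcess f ybar z + inner ℝ q (z - x) + C * ‖z - x‖ ^ 2 :=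
    hδm ⟨Metric.ball_subset_ball (min_le_right _ _) hz, hzΩ⟩
  exact ⟨i, by dsimp only; linarith⟩

end Scalarization

/-! ### Almost critical points at infinity -/

theorem exists_mem_norm_ge {E : Type*} [NormedAddCommGroup E] {U : Set E}
    (hU : ¬ Bornology.IsBounded U) (R : ℝ) : ∃ x ∈ U, R ≤ ‖x‖ := by
  by_contra! h
  exact hU (isBounded_iff_forall_norm_le.2 ⟨R, fun x hx => (h x hx).le⟩)

/-- The infimum of T is the lower limit of φ along U at infinity. It is reached within ε / 2
arbitrarily far out, while beyond some radius R₀ no value falls below it by ε / 2; choosing ‖x‖ ≥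
2R₀ covers all z with ‖z‖ ≥ ‖x‖ / 2. -/
theorem exists_almost_minimizer_at_infinity {E : Type*} [NormedAddCommGroup E] {U : Set E}
    {φ : E → ℝ} {A B : ℝ} (hU : ¬ Bornology.IsBounded U) (hA : ∀ x ∈ U, A ≤ φ x)
    (hB : ∀ x ∈ U, φ x ≤ B) {ε : ℝ} (hε : 0 < ε) (R : ℝ) :
    ∃ x ∈ U, R ≤ ‖x‖ ∧ ∀ z ∈ U, ‖x‖ / 2 ≤ ‖z‖ → φ x ≤ φ z + ε := by
  set T : Set ℝ := {t | ∀ R : ℝ, ∃ x ∈ U, R ≤ ‖x‖ ∧ φ x ≤ t} with hT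
  have hTne : T.Nonempty := ⟨B, fun R => by
    obtain ⟨x, hx, hR⟩ := exists_mem_norm_ge hU R
    exact ⟨x, hx, hR, hB x hx⟩⟩
  have hTb : BddBelow T := ⟨A, fun t ht => by
    obtain ⟨x, hx, -, h⟩ := ht 0
    exact (hA x hx).trans h⟩
  obtain ⟨t, htT, ht⟩ := exists_lt_of_csInf_lt hTne (lt_add_of_pos_right (sInf T) (half_pos hε))
  have hnot : sInf T - ε / 2 ∉ T := fun h => by linarith [csInf_le hTb h]
  simp only [hT, Set.mem_ofPred_eq, not_forall, not_exists, not_and, not_le] at hnot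
  obtain ⟨R₀, hR₀⟩ := hnot
  obtain ⟨x, hxU, hxR, hxt⟩ := htT (max R (2 * R₀))
  have h1 := le_max_left R (2 * R₀)
  have h2 := le_max_right R (2 * R₀)
  refine ⟨x, hxU, h1.trans hxR, fun z hz hzx => ?_⟩
  linarith [hR₀ z hz (by linarith)]

section Rabier

variable {n m : ℕ} {f : Euc n → Euc m} {Ω : Set (Euc n)} {ybar : Euc m}

theorem rabier_nonneg (f : Euc n → Euc m) (Ω : Set (Euc n)) (x : Euc n) : 0 ≤ rabier f Ω x := by
  refine Real.sInf_nonneg ?_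
  rintro r ⟨v, w, l, -, -, -, -, rfl⟩
  exact norm_nonneg _

theorem rabier_le {x w : Euc n} {v : Fin m → Euc n} {l : Fin m → ℝ}
    (hv : ∀ i, v i ∈ symSubdifferential f i x) (hw : w ∈ limitingNormalCone Ω x)
    (hl : ∀ i, 0 ≤ l i) (hl1 : ∑ i, l i = 1) : rabier f Ω x ≤ ‖∑ i, l i • v i + w‖ := by
  refine csInf_le ⟨0, ?_⟩ ⟨v, w, l, hv, hw, hl, hl1, rfl⟩
  rintro r ⟨v, w, l, -, -, -, -, rfl⟩
  exact norm_nonneg _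

/-- On an unbounded sublevel set on which `f` is bounded below, `‖x‖ * rabier f Ω x` gets
arbitrarily small at infinity. -/
theorem exists_norm_mul_rabier_le [NeZero m] (hf : LocallyLipschitz f) (hΩ : IsClosed Ω)
    (hU : ¬ Bornology.IsBounded (sublevel f Ω ybar)) {A : ℝ}
    (hA : ∀ x ∈ sublevel f Ω ybar, A ≤ maxExcess f ybar x) {ε : ℝ} (hε : 0 < ε) (R : ℝ) :
    ∃ x ∈ sublevel f Ω ybar, R ≤ ‖x‖ ∧ ‖x‖ * rabier f Ω x ≤ 12 * ε := by
  obtain ⟨x, ⟨hxΩ, hxy⟩, hxR, hx⟩ := exists_almost_minimizer_at_infinity hU hA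
    (fun x hx => maxExcess_nonpos_iff.2 hx.2) hε (max (2 * R) 1)
  have hx1 : 1 ≤ ‖x‖ := (le_max_right _ _).trans hxR
  have hR : 2 * R ≤ ‖x‖ := (le_max_left _ _).trans hxR
  have hxpos : 0 < ‖x‖ := by linarith
  have hφc := continuous_maxExcess (ybar := ybar) hf.continuous
  set ρ : ℝ := ‖x‖ with hρ
  -- On the sphere ‖z - x‖ = ρ / 2 the penalty equals 2ε, more than the possible gain ε, so the
  -- minimizer is interior. The penalty gradient there is at most αρ = 8ε / ρ, and ‖z‖ ≤ 3ρ / 2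
  -- gives the constant 12.
  set α : ℝ := 8 * ε / ρ ^ 2 with hα
  have hαpos : 0 < α := by positivity
  have hαρ : α * ρ ^ 2 = 8 * ε := by rw [hα]; field_simp
  -- Minimizing over Ω rather than over the sublevel set keeps normals to the sublevel out of the
  -- multiplier rule; the minimizer lies in the sublevel anyway, since φ(z) ≤ φ(x) ≤ 0.
  obtain ⟨z, ⟨hzΩ, hzB⟩, hzm⟩ := ((isCompact_closedBall x (ρ / 2)).inter_left hΩ).exists_isMinOn
    ⟨x, hxΩ, Metric.mem_closedBall_self (by positivity)⟩
    (f := fun z => maxExcess f ybar z + α * ‖z - x‖ ^ 2) (by fun_prop)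
  have hzm : ∀ w ∈ Ω, ‖w - x‖ ≤ ρ / 2 → maxExcess f ybar z + α * ‖z - x‖ ^ 2 ≤
      maxExcess f ybar w + α * ‖w - x‖ ^ 2 := fun w h1 h2 => hzm ⟨h1, mem_closedBall_iff_norm.2 h2⟩
  have h0 : maxExcess f ybar z + α * ‖z - x‖ ^ 2 ≤ maxExcess f ybar x := by
    simpa using hzm x hxΩ (by simpa using (half_pos hxpos).le)
  have hzx : ‖z - x‖ ≤ ρ / 2 := mem_closedBall_iff_norm.1 hzB
  have hφx : maxExcess f ybar x ≤ 0 := maxExcess_nonpos_iff.2 hxy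
  have hzU : z ∈ sublevel f Ω ybar := ⟨hzΩ, maxExcess_nonpos_iff.1 (by
    have : 0 ≤ α * ‖z - x‖ ^ 2 := by positivity
    linarith)⟩
  have hz1 : ρ / 2 ≤ ‖z‖ := by
    have := norm_sub_norm_le x z
    rw [norm_sub_rev] at this
    linarith
  have hz2 : ‖z‖ ≤ 3 * ρ / 2 := by
    have := norm_sub_norm_le z x
    linarith
  have hlt : ‖z - x‖ < ρ / 2 := by
    have h1 := hx z hzU hz1
    have h2 : α * ‖z - x‖ ^ 2 < α * (ρ / 2) ^ 2 := by linarith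
    exact lt_of_pow_lt_pow_left₀ 2 (by positivity) (lt_of_mul_lt_mul_left h2 hαpos.le)
  obtain ⟨L, r, hL, hr, hLip⟩ := exists_lipschitz_ball hf z
  obtain ⟨v, l, w, hv, -, hl, hl1, hw, hsum⟩ := exists_multipliers_maxExcess (ybar := ybar)
    (q := (2 * α) • (z - x)) (C := α) hf.continuous hΩ hzΩ hL hr hLip (by
      have hB : Metric.ball x (ρ / 2) ∈ 𝓝 z :=
        Metric.isOpen_ball.mem_nhds (mem_ball_iff_norm.2 hlt)
      filter_upwards [self_mem_nhdsWithin, mem_nhdsWithin_of_mem_nhds hB] with y hyΩ hy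
      have h1 := hzm y hyΩ (mem_ball_iff_norm.1 hy).le
      have h2 : y - x = (z - x) + (y - z) := by abel
      rw [h2, norm_add_sq_real] at h1
      rw [real_inner_smul_left]
      linarith)
  have hle := rabier_le (f := f) (fun i => Or.inl (hv i)) hw hl hl1
  have h2 : ∑ i, l i • v i + w = -((2 * α) • (z - x)) := by
    rw [eq_neg_iff_add_eq_zero, ← hsum]; abel
  rw [h2, norm_neg, norm_smul, Real.norm_of_nonneg (by positivity)] at hle
  refine ⟨z, hzU, by linarith, ?_⟩
  calc ‖z‖ * rabier f Ω z ≤ (3 * ρ / 2) * (2 * α * (ρ / 2)) := by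
        have := rabier_nonneg f Ω z
        gcongr
        exact hle.trans (by gcongr)
    _ = 3 / 2 * (α * ρ ^ 2) := by ring
    _ = 12 * ε := by rw [hαρ]; ring

end Rabier

/-! ### Minimizers on spheres and the set Γ(f, Ω) -/

section Tangency

variable {n m : ℕ} {f : Euc n → Euc m} {Ω : Set (Euc n)} {ybar : Euc m}

theorem isCompact_multipliers (m : ℕ) :
    IsCompact {p : (Fin m → ℝ) × ℝ | (∀ i, 0 ≤ p.1 i) ∧ ∑ i, p.1 i + |p.2| = 1} := by
  refine IsCompact.of_isClosed_subset
    ((isCompact_Icc (a := (0 : Fin m → ℝ)) (b := 1)).prod (isCompact_Icc (a := (-1 : ℝ)) (b := 1)))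
    ?_ ?_
  · refine IsClosed.inter ?_ ?_
    · exact isClosed_le (continuous_const (y := (0 : Fin m → ℝ))) continuous_fst
    · exact isClosed_eq (by fun_prop) continuous_const
  · rintro ⟨l, μ⟩ ⟨hl, h1⟩
    dsimp only at hl h1
    have hs : 0 ≤ ∑ i, l i := Finset.sum_nonneg fun i _ => hl i
    refine ⟨⟨hl, fun i => ?_⟩, abs_le.1 (by dsimp only; linarith)⟩
    have := Finset.single_le_sum (f := l) (fun i _ => hl i) (Finset.mem_univ i)
    have h2 := abs_nonneg μ
    simp only [Pi.one_apply]
    linarith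

/-- With D = ‖z‖² - ‖x‖² this is a quadratic upper model at z of the penalty k(‖w‖² - ‖x‖²)². Its
gradient is a multiple of z, the source of the term μx in Γ(f, Ω). -/
theorem sphere_penalty_le {E : Type*} [NormedAddCommGroup E] [InnerProductSpace ℝ E]
    {z w : E} {k D : ℝ} (hk : 0 ≤ k) (hw : ‖w - z‖ ≤ 1) :
    k * (‖w‖ ^ 2 - ‖z‖ ^ 2 + D) ^ 2 ≤ k * D ^ 2 + inner ℝ ((4 * k * D) • z) (w - z) +
      (2 * k * D + k * (2 * ‖z‖ + 1) ^ 2) * ‖w - z‖ ^ 2 := by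
  have h1 : w = z + (w - z) := by abel
  have h2 : ‖w‖ ^ 2 - ‖z‖ ^ 2 = 2 * inner ℝ z (w - z) + ‖w - z‖ ^ 2 := by
    conv_lhs => rw [h1, norm_add_sq_real]
    ring
  set h := w - z
  have h3 : |2 * inner ℝ z h + ‖h‖ ^ 2| ≤ (2 * ‖z‖ + 1) * ‖h‖ := by
    calc |2 * inner ℝ z h + ‖h‖ ^ 2| ≤ |2 * inner ℝ z h| + |‖h‖ ^ 2| := abs_add_le _ _
      _ ≤ 2 * (‖z‖ * ‖h‖) + 1 * ‖h‖ := by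
        rw [abs_mul, abs_of_pos (zero_lt_two' ℝ), abs_of_nonneg (sq_nonneg ‖h‖), sq]
        gcongr
        exact abs_real_inner_le_norm z h
      _ = _ := by ring
  have h4 : k * (2 * inner ℝ z h + ‖h‖ ^ 2) ^ 2 ≤ k * ((2 * ‖z‖ + 1) * ‖h‖) ^ 2 := by
    rw [← sq_abs]
    gcongr
  rw [h2, real_inner_smul_left]
  linarith

/-- Minimizers of the scalarization over spheres lie in `Γ(f, Ω)`. -/
theorem mem_gammaSet_of_isMinOn_sphere [NeZero m] (hf : LocallyLipschitz f) (hΩ : IsClosed Ω)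
    {x : Euc n} (hx : x ∈ Ω)
    (hmin : ∀ z ∈ Ω, ‖z‖ = ‖x‖ → maxExcess f ybar x ≤ maxExcess f ybar z) :
    x ∈ gammaSet f Ω := by
  have hφc := continuous_maxExcess (ybar := ybar) hf.continuous
  have hK : IsCompact (Ω ∩ Metric.closedBall x 1) := (isCompact_closedBall x 1).inter_left hΩ
  have hxB : x ∈ Metric.closedBall x 1 := Metric.mem_closedBall_self zero_le_one
  -- The sphere constraint is penalized with growing weight k; the extra ‖z - x‖² makes x the only
  -- possible limit of the minimizers.
  have hex : ∀ k : ℕ, ∃ z ∈ Ω ∩ Metric.closedBall x 1, ∀ w ∈ Ω ∩ Metric.closedBall x 1,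
      maxExcess f ybar z + ‖z - x‖ ^ 2 + k * (‖z‖ ^ 2 - ‖x‖ ^ 2) ^ 2 ≤
      maxExcess f ybar w + ‖w - x‖ ^ 2 + k * (‖w‖ ^ 2 - ‖x‖ ^ 2) ^ 2 := fun k => by
    obtain ⟨z, hz, hzm⟩ := hK.exists_isMinOn ⟨x, hx, hxB⟩ (f := fun z =>
      maxExcess f ybar z + ‖z - x‖ ^ 2 + k * (‖z‖ ^ 2 - ‖x‖ ^ 2) ^ 2) (by fun_prop)
    exact ⟨z, hz, fun w hw => hzm hw⟩
  choose z hzK hzm using hex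
  have hz0 : ∀ k : ℕ, maxExcess f ybar (z k) + ‖z k - x‖ ^ 2 +
      k * (‖z k‖ ^ 2 - ‖x‖ ^ 2) ^ 2 ≤ maxExcess f ybar x := fun k => by
    simpa using hzm k x ⟨hx, hxB⟩
  obtain ⟨y, ⟨hyΩ, -⟩, σ, hσ, hlim⟩ := hK.tendsto_subseq hzK
  have hφlim : Tendsto (fun k => maxExcess f ybar (z (σ k))) atTop (𝓝 (maxExcess f ybar y)) :=
    (hφc.tendsto y).comp hlim
  have hDlim : Tendsto (fun k => (‖z (σ k)‖ ^ 2 - ‖x‖ ^ 2) ^ 2) atTop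
      (𝓝 ((‖y‖ ^ 2 - ‖x‖ ^ 2) ^ 2)) :=
    (((hlim.norm.pow 2).sub_const _).pow 2)
  have hD : (‖y‖ ^ 2 - ‖x‖ ^ 2) ^ 2 ≤ 0 := by
    refine le_of_tendsto_of_tendsto hDlim ((hφlim.const_sub (maxExcess f ybar x)).div_atTop
      (tendsto_natCast_atTop_atTop.comp hσ.tendsto_atTop)) ?_
    filter_upwards [eventually_ge_atTop 1] with k hk
    have hk' : (0 : ℝ) < (σ k : ℝ) := by
      exact_mod_cast (Nat.lt_of_lt_of_le Nat.zero_lt_one hk).trans_le (hσ.id_le k)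
    simp only [Function.comp]
    rw [le_div_iff₀ hk']
    linarith [hz0 (σ k), sq_nonneg ‖z (σ k) - x‖]
  have hyx : y = x := by
    have h1 : ‖y‖ ^ 2 = ‖x‖ ^ 2 := by
      have := pow_eq_zero_iff (two_ne_zero) |>.1 (le_antisymm hD (sq_nonneg _))
      linarith
    have h2 : ‖y‖ = ‖x‖ := (pow_left_inj₀ (norm_nonneg _) (norm_nonneg _) two_ne_zero).1 h1
    have h3 : maxExcess f ybar y + ‖y - x‖ ^ 2 ≤ maxExcess f ybar x := by
      refine le_of_tendsto (hφlim.add ((hlim.sub_const x).norm.pow 2))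
        (Eventually.of_forall fun k => ?_)
      have : 0 ≤ (σ k : ℝ) * (‖z (σ k)‖ ^ 2 - ‖x‖ ^ 2) ^ 2 := by positivity
      have h4 := hz0 (σ k)
      simp only [Function.comp]
      linarith
    have h4 : ‖y - x‖ ^ 2 ≤ 0 := by linarith [hmin y hyΩ h2]
    have h5 := pow_eq_zero_iff (two_ne_zero) |>.1 (le_antisymm h4 (sq_nonneg _))
    exact sub_eq_zero.1 (norm_eq_zero.1 h5)
  rw [hyx] at hlim
  obtain ⟨L, r, hL, hr, hLip⟩ := exists_lipschitz_ball hf x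
  obtain ⟨N, hN⟩ := eventually_atTop.1
    (hlim.eventually (Metric.ball_mem_nhds x (lt_min zero_lt_one (half_pos hr))))
  have hlim' : Tendsto (fun k => z (σ (k + N))) atTop (𝓝 x) := hlim.comp (tendsto_add_atTop_nat N)
  have hmult : ∀ k : ℕ, ∃ (v : Fin m → Euc n) (l : Fin m → ℝ) (w : Euc n) (μ t : ℝ),
      (∀ i, v i ∈ subdifferential (fun y => f y i) (z (σ (k + N)))) ∧ (∀ i, ‖v i‖ ≤ L) ∧
      w ∈ limitingNormalCone Ω (z (σ (k + N))) ∧ 0 ≤ t ∧ t ≤ 1 ∧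
      ((∀ i, 0 ≤ l i) ∧ ∑ i, l i + |μ| = 1) ∧
      ∑ i, l i • v i + μ • z (σ (k + N)) + (2 * t) • (z (σ (k + N)) - x) + w = 0 := by
    intro k
    have hball : z (σ (k + N)) ∈ Metric.ball x (min 1 (r / 2)) := hN _ (Nat.le_add_left N k)
    have hm := hzm (σ (k + N))
    have hΩk := (hzK (σ (k + N))).1
    set p := z (σ (k + N)) with hp
    set κ : ℝ := (σ (k + N) : ℝ) with hκ
    have hκ0 : 0 ≤ κ := Nat.cast_nonneg _
    set D : ℝ := ‖p‖ ^ 2 - ‖x‖ ^ 2 with hD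
    have hsub : Metric.ball p (r / 2) ⊆ Metric.ball x r := by
      refine Metric.ball_subset_ball' ?_
      have := (Metric.mem_ball.1 hball).trans_le (min_le_right _ _)
      linarith
    obtain ⟨v, l, w, hv, hvL, hl, hl1, hw, h0⟩ := exists_multipliers_maxExcess (ybar := ybar)
      (q := (2 : ℝ) • (p - x) + (4 * κ * D) • p)
      (C := 1 + (2 * κ * D + κ * (2 * ‖p‖ + 1) ^ 2))
      hf.continuous hΩ hΩk hL (half_pos hr)
      (fun i a ha b hb => hLip i a (hsub ha) b (hsub hb)) (by
        have hB : Metric.ball x 1 ∈ 𝓝 p :=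
          Metric.isOpen_ball.mem_nhds (Metric.ball_subset_ball (min_le_left _ _) hball)
        filter_upwards [self_mem_nhdsWithin, mem_nhdsWithin_of_mem_nhds hB,
          mem_nhdsWithin_of_mem_nhds (Metric.closedBall_mem_nhds p zero_lt_one)] with y hyΩ hy hyp
        have h1 := hm y ⟨hyΩ, Metric.ball_subset_closedBall hy⟩
        have h2 : y - x = (p - x) + (y - p) := by abel
        have h3 := sphere_penalty_le (D := D) hκ0 (mem_closedBall_iff_norm.1 hyp)
        have h4 : ‖y‖ ^ 2 - ‖p‖ ^ 2 + D = ‖y‖ ^ 2 - ‖x‖ ^ 2 := by rw [hD]; ring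
        rw [h4] at h3
        rw [h2, norm_add_sq_real] at h1
        rw [inner_add_left, real_inner_smul_left]
        linarith)
    -- The penalty multiplier 4κD may be unbounded in k, so the relation is rescaled to ∑ λ_i + |μ|
    -- = 1, which gives compactness; all λ_i may vanish in the limit. Since t ≤ 1, the localizing
    -- term still tends to 0.
    set t : ℝ := (1 + |4 * κ * D|)⁻¹ with ht
    have habs := abs_nonneg (4 * κ * D)
    have ht0 : 0 < t := by positivity
    have ht1 : t * (1 + |4 * κ * D|) = 1 := inv_mul_cancel₀ (by positivity)
    refine ⟨v, fun i => t * l i, t • w, t * (4 * κ * D), t, hv, hvL,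
      smul_mem_limitingNormalCone ht0 hw, ht0.le, by nlinarith,
      ⟨fun i => mul_nonneg ht0.le (hl i), ?_⟩, ?_⟩
    · rw [← Finset.mul_sum, hl1, abs_mul, abs_of_pos ht0]
      linarith
    · have h1 := congrArg (fun a => t • a) h0
      simp only [smul_add, Finset.smul_sum, smul_smul, smul_zero] at h1
      rw [mul_comm 2 t, ← h1]
      abel
  choose v l w μ t hv hvL hw ht0 ht1 hlμ h0 using hmult
  have hβ : Tendsto (fun k => (2 * t k) • (z (σ (k + N)) - x)) atTop (𝓝 0) := by
    have h1 : Tendsto (fun k => 2 * ‖z (σ (k + N)) - x‖) atTop (𝓝 0) := by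
      simpa using ((hlim'.sub_const x).norm).const_mul 2
    refine squeeze_zero_norm (fun k => ?_) h1
    rw [norm_smul, Real.norm_of_nonneg (mul_nonneg zero_le_two (ht0 k))]
    have := ht1 k
    gcongr
    linarith
  obtain ⟨l', μ', v', w', ⟨hl', hμ'⟩, hv', -, hw', hsum⟩ := exists_limit_multipliers
    (f := fun i z => f z i) (y := fun k _ => z (σ (k + N))) (continuous_coord hf.continuous)
    (isCompact_multipliers m) hlim' hlim' hβ (fun _ => hlim') hv hvL hw hlμ h0
  refine ⟨hx, v', l', μ', fun i => Or.inl (hv' i), hl', hμ', w', hw', ?_⟩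
  rw [← hsum, add_zero]

/-- Minimize the scalarization over the part of Ω on the sphere through a far sublevel point: the
norm is kept and the value does not increase, so the minimizer stays in the sublevel. -/
theorem exists_mem_gammaSet_norm_ge [NeZero m] (hf : LocallyLipschitz f) (hΩ : IsClosed Ω)
    (hU : ¬ Bornology.IsBounded (sublevel f Ω ybar)) (R : ℝ) :
    ∃ x ∈ sublevel f Ω ybar, R ≤ ‖x‖ ∧ x ∈ gammaSet f Ω := by
  obtain ⟨x, hx, hxR⟩ := exists_mem_norm_ge hU R
  have hφc := continuous_maxExcess (ybar := ybar) hf.continuous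
  obtain ⟨z, ⟨hzΩ, hz⟩, hzm⟩ := ((isCompact_sphere (0 : Euc n) ‖x‖).inter_left hΩ).exists_isMinOn
    ⟨x, hx.1, by simp⟩ hφc.continuousOn
  rw [mem_sphere_zero_iff_norm] at hz
  have hzx : maxExcess f ybar z ≤ maxExcess f ybar x := hzm ⟨hx.1, by simp⟩
  refine ⟨z, ⟨hzΩ, maxExcess_nonpos_iff.1 (hzx.trans (maxExcess_nonpos_iff.2 hx.2))⟩,
    hz ▸ hxR, ?_⟩
  exact mem_gammaSet_of_isMinOn_sphere (ybar := ybar) hf hΩ hzΩ fun y hy hyz =>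
    hzm ⟨hy, by rw [mem_sphere_zero_iff_norm, hyz, hz]⟩

end Tangency

/-! ### Equivalence with boundedness of the sublevel, and existence -/

theorem isCompact_setOf_leqq {m : ℕ} (a b : Euc m) :
    IsCompact {z : Euc m | Leqq a z ∧ Leqq z b} := by
  have h := (isCompact_Icc (a := fun i => a i) (b := fun i => b i)).image
    (PiLp.continuous_toLp 2 fun _ : Fin m => ℝ)
  convert h using 1
  ext z
  simp only [leqq_iff, Set.mem_ofPred_eq, Set.mem_image, Set.mem_Icc, Pi.le_def]
  constructor
  · exact fun hz => ⟨fun i => z i, hz, rfl⟩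
  · rintro ⟨y, hy, rfl⟩
    exact hy

section Equivalence

variable {n m : ℕ} {f : Euc n → Euc m} {Ω : Set (Euc n)} {ybar : Euc m}

theorem exists_isCompact_image (hbdd : SectionBounded (f '' Ω) ybar) :
    ∃ (a : Euc m) (K : Set (Euc m)), IsCompact K ∧
      ∀ x ∈ sublevel f Ω ybar, Leqq a (f x) ∧ f x ∈ K := by
  obtain ⟨a, ha⟩ := hbdd
  refine ⟨a, _, isCompact_setOf_leqq a ybar, fun x hx => ?_⟩
  have : Leqq a (f x) := ha _ ⟨⟨x, hx.1, rfl⟩, hx.2⟩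
  exact ⟨this, this, hx.2⟩

theorem not_isBounded_sublevel {x : ℕ → Euc n} (hx : ∀ k, x k ∈ Ω)
    (hxy : ∀ k, Leqq (f (x k)) ybar) (h : Tendsto (fun k => ‖x k‖) atTop atTop) :
    ¬ Bornology.IsBounded (sublevel f Ω ybar) := by
  intro hb
  obtain ⟨C, hC⟩ := isBounded_iff_forall_norm_le.1 hb
  obtain ⟨k, hk⟩ := (h.eventually (eventually_gt_atTop C)).exists
  linarith [hC (x k) ⟨hx k, hxy k⟩]

theorem tendsto_norm_of_le {x : ℕ → Euc n} (h : ∀ k : ℕ, (k : ℝ) ≤ ‖x k‖) :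
    Tendsto (fun k => ‖x k‖) atTop atTop :=
  tendsto_atTop_mono h tendsto_natCast_atTop_atTop

theorem properAtSublevel_iff (hbdd : SectionBounded (f '' Ω) ybar) :
    ProperAtSublevel f Ω ybar ↔ Bornology.IsBounded (sublevel f Ω ybar) := by
  constructor
  · intro hP
    by_contra hU
    choose x hxU hx using fun k : ℕ => exists_mem_norm_ge hU (k : ℝ)
    obtain ⟨a, K, hK, haK⟩ := exists_isCompact_image hbdd
    obtain ⟨C, hC⟩ := isBounded_iff_forall_norm_le.1 hK.isBounded
    obtain ⟨k, hk⟩ := ((hP x (fun k => (hxU k).1) (tendsto_norm_of_le hx)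
      fun k => (hxU k).2).eventually (eventually_gt_atTop C)).exists
    linarith [hC _ (haK _ (hxU k)).2]
  · intro hb x hx hn hxy
    exact absurd hb (not_isBounded_sublevel hx hxy hn)

theorem palaisSmaleAt_of_isBounded (hb : Bornology.IsBounded (sublevel f Ω ybar)) :
    PalaisSmaleAt f Ω ybar := by
  refine Set.eq_empty_of_forall_notMem ?_
  rintro y ⟨x, hx, hxy, hn, -, -⟩
  exact not_isBounded_sublevel hx hxy hn hb

theorem mTameAt_of_isBounded (hb : Bornology.IsBounded (sublevel f Ω ybar)) :
    MTameAt f Ω ybar := by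
  refine Set.eq_empty_of_forall_notMem ?_
  rintro y ⟨x, hx, hxy, hn, -⟩
  exact not_isBounded_sublevel (fun k => (hx k).1) hxy hn hb

/-- Once ‖x‖ ≥ 1, ν(x) ≤ ‖x‖ ν(x), so the weak asymptotic set is contained in the other one. -/
theorem weakPalaisSmaleAt_of_palaisSmaleAt (h : PalaisSmaleAt f Ω ybar) :
    WeakPalaisSmaleAt f Ω ybar := by
  refine Set.eq_empty_of_forall_notMem ?_
  rintro y ⟨x, hx, hxy, hn, hfy, hν⟩
  have hmem : y ∈ palaisSmaleSet f Ω ybar := by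
    refine ⟨x, hx, hxy, hn, hfy, ?_⟩
    refine tendsto_of_tendsto_of_tendsto_of_le_of_le' tendsto_const_nhds hν
      (Eventually.of_forall fun k => rabier_nonneg _ _ _) ?_
    filter_upwards [hn.eventually (eventually_ge_atTop 1)] with k hk
    exact le_mul_of_one_le_left (rabier_nonneg _ _ _) hk
  rw [show palaisSmaleSet f Ω ybar = ∅ from h] at hmem
  exact hmem

theorem isBounded_of_weakPalaisSmaleAt [NeZero m] (hf : LocallyLipschitz f) (hΩ : IsClosed Ω)
    (hbdd : SectionBounded (f '' Ω) ybar) (h : WeakPalaisSmaleAt f Ω ybar) :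
    Bornology.IsBounded (sublevel f Ω ybar) := by
  by_contra hU
  obtain ⟨a, K, hK, haK⟩ := exists_isCompact_image hbdd
  -- Any single coordinate bounds the maximum from below; coordinate 0 exists because m is nonzero.
  have hA : ∀ x ∈ sublevel f Ω ybar, a 0 - ybar 0 ≤ maxExcess f ybar x := fun x hx => by
    have h1 := leqq_iff.1 (haK x hx).1 0
    have h2 := le_maxExcess (f := f) (ybar := ybar) x 0
    linarith
  choose x hxU hx hν using fun k : ℕ => exists_norm_mul_rabier_le hf hΩ hU hA
    (ε := 1 / ((k : ℝ) + 1)) (by positivity) (k : ℝ)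
  obtain ⟨y, -, σ, hσ, hlim⟩ := hK.tendsto_subseq fun k => (haK _ (hxU k)).2
  have hmem : y ∈ weakPalaisSmaleSet f Ω ybar := by
    refine ⟨x ∘ σ, fun k => (hxU _).1, fun k => (hxU _).2,
      (tendsto_norm_of_le hx).comp hσ.tendsto_atTop, hlim, ?_⟩
    have h1 : Tendsto (fun k => ‖x k‖ * rabier f Ω (x k)) atTop (𝓝 0) :=
      squeeze_zero (fun k => mul_nonneg (norm_nonneg _) (rabier_nonneg _ _ _)) hν
        (by simpa using tendsto_one_div_add_atTop_nhds_zero_nat (𝕜 := ℝ).const_mul 12)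
    exact h1.comp hσ.tendsto_atTop
  rw [show weakPalaisSmaleSet f Ω ybar = ∅ from h] at hmem
  exact hmem

theorem isBounded_of_mTameAt [NeZero m] (hf : LocallyLipschitz f) (hΩ : IsClosed Ω)
    (hbdd : SectionBounded (f '' Ω) ybar) (h : MTameAt f Ω ybar) :
    Bornology.IsBounded (sublevel f Ω ybar) := by
  by_contra hU
  obtain ⟨a, K, hK, haK⟩ := exists_isCompact_image hbdd
  choose x hxU hx hΓ using fun k : ℕ => exists_mem_gammaSet_norm_ge hf hΩ hU (k : ℝ)
  obtain ⟨y, -, σ, hσ, hlim⟩ := hK.tendsto_subseq fun k => (haK _ (hxU k)).2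
  have hmem : y ∈ tangencySet f Ω ybar :=
    ⟨x ∘ σ, fun k => hΓ _, fun k => (hxU _).2,
      (tendsto_norm_of_le hx).comp hσ.tendsto_atTop, hlim⟩
  rw [show tangencySet f Ω ybar = ∅ from h] at hmem
  exact hmem

/-- A minimizer of ∑ f_i over the compact sublevel is efficient: a point dominating it is again in
the sublevel, so its sum cannot be smaller and all components must agree. -/
theorem exists_isParetoEfficient (hf : Continuous f) (hΩ : IsClosed Ω) (hy : ybar ∈ f '' Ω)
    (hb : Bornology.IsBounded (sublevel f Ω ybar)) : ∃ xbar, IsParetoEfficient f Ω xbar := by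
  have hc : IsClosed (sublevel f Ω ybar) := by
    have h : IsClosed {x | Leqq (f x) ybar} := by
      have h1 : {x | Leqq (f x) ybar} = {x | (fun i => f x i) ≤ fun i => ybar i} := by
        ext x
        exact leqq_iff
      rw [h1]
      exact isClosed_le (continuous_pi (continuous_coord hf)) continuous_const
    exact hΩ.inter h
  obtain ⟨x₀, hx₀, hx₀y⟩ := hy
  obtain ⟨x, ⟨hxΩ, hxy⟩, hxm⟩ := (Metric.isCompact_of_isClosed_isBounded hc hb).exists_isMinOn
    ⟨x₀, hx₀, leqq_iff.2 fun i => by rw [hx₀y]⟩ (f := fun x => ∑ i, f x i) (by fun_prop)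
  refine ⟨x, hxΩ, ?_⟩
  rintro ⟨z, hzΩ, hzx, hne⟩
  rw [leqq_iff] at hzx hxy
  have h1 : ∑ i, f x i ≤ ∑ i, f z i :=
    hxm ⟨hzΩ, leqq_iff.2 fun i => (hzx i).trans (hxy i)⟩
  have h2 := (Finset.sum_eq_sum_iff_of_le fun i _ => hzx i).1
    (le_antisymm (Finset.sum_le_sum fun i _ => hzx i) h1)
  exact hne (PiLp.ext fun i => h2 i (Finset.mem_univ i))

end Equivalence

end VectorOpt

theorem corollary4p1 {n m : ℕ} (hm : 1 ≤ m)
    (f : VectorOpt.Euc n → VectorOpt.Euc m) (hf : LocallyLipschitz f)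
    (Ω : Set (VectorOpt.Euc n)) (hΩ : IsClosed Ω)
    (ybar : VectorOpt.Euc m) (hy : ybar ∈ f '' Ω)
    (hbdd : VectorOpt.SectionBounded (f '' Ω) ybar) :
    List.TFAE
      [VectorOpt.ProperAtSublevel f Ω ybar,
       VectorOpt.PalaisSmaleAt f Ω ybar,
       VectorOpt.WeakPalaisSmaleAt f Ω ybar,
       VectorOpt.MTameAt f Ω ybar] ∧
    ((VectorOpt.ProperAtSublevel f Ω ybar ∨ VectorOpt.PalaisSmaleAt f Ω ybar ∨
        VectorOpt.WeakPalaisSmaleAt f Ω ybar ∨ VectorOpt.MTameAt f Ω ybar) →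
      ∃ xbar : VectorOpt.Euc n, VectorOpt.IsParetoEfficient f Ω xbar) := by
  have : NeZero m := ⟨by omega⟩
  have h1 := VectorOpt.properAtSublevel_iff hbdd
  have h34 := VectorOpt.isBounded_of_weakPalaisSmaleAt hf hΩ hbdd
  have h4 := VectorOpt.isBounded_of_mTameAt hf hΩ hbdd
  have h23 := VectorOpt.weakPalaisSmaleAt_of_palaisSmaleAt (f := f) (Ω := Ω) (ybar := ybar)
  constructor
  · tfae_have 1 → 2 := fun h => VectorOpt.palaisSmaleAt_of_isBounded (h1.1 h)
    tfae_have 2 → 3 := h23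
    tfae_have 3 → 4 := fun h => VectorOpt.mTameAt_of_isBounded (h34 h)
    tfae_have 4 → 1 := fun h => h1.2 (h4 h)
    tfae_finish
  · rintro (h | h | h | h)
    · exact VectorOpt.exists_isParetoEfficient hf.continuous hΩ hy (h1.1 h)
    · exact VectorOpt.exists_isParetoEfficient hf.continuous hΩ hy (h34 (h23 h))
    · exact VectorOpt.exists_isParetoEfficient hf.continuous hΩ hy (h34 h)
    · exact VectorOpt.exists_isParetoEfficient hf.continuous hΩ hy (h4 h)
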